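/- For $n\ge 2$ let $Q_n=\{1,\dots,n\}$. Transformations of $Q_n$ are denoted as follows: $\mathbf 1$ is the identity; $(p,p+1,\dots,q)$ is a cycle, fixing all other elements; $(p\to q)$ sends $p$ to $q$ and fixes all other elements; $(Q_m\to q)$ sends $1,\dots,m$ to $q$ and fixes $m+1,\dots,n$. Let $\mathcal D_n$ be the DFA with state set $Q_n$, initial state $1$, set of final states $\{n\}$, and letters acting on $Q_n$ as follows. * If $n\ge 4$: $\Sigma=\{a,b,c,d,e,f\}$ with $a=(2,3,\dots,n-1)$, $b=(2,3)$, $c=(n-1\to 2)$, $d=(n-1\to 1)$, $e=(Q_{n-1}\to 2)$, $f=(2\to n)$. * If $n=3$: $\Sigma=\{a,b,c,d\}$ with $a=\mathbf 1$, $b=(Q_2\to 2)$, $c=(2\to 3)$, $d=(2\to 1)$. * If $n=2$: $\Sigma=\{a,b\}$ with $a=\mathbf 1$, $b=(Q_2\to 2)$. Let $L_n$ be the language accepted by $\mathcal D_n$, and let $K_i$ be the set of words accepted from state $i$. The complexity $\kappa(L)$ of a language $L$ is the number of its distinct left quotients $w^{-1}L=\{v\mid wv\in L\}$, $w\in\Sigma^*$.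 An atom of $L$ is a non-empty intersection in which each quotient of $L$ occurs either uncomplemented or complemented. Theorem. For every $n\ge 2$, $L_n$ is a two-sided ideal, that is, $L_n=\Sigma^*L_n\Sigma^*$; it has complexity $n$, and its quotients are the pairwise distinct languages $K_1,\dots,K_n$. It has exactly $2^{n-2}+1$ atoms, and for every $S\subseteq Q_n$ such that $A_S=\bigcap_{i\in S}K_i\cap\bigcap_{i\in Q_n\setminus S}\overline{K_i}$ is an atom, $$\kappa(A_S)=\begin{cases} n, & S=Q_n;\\ 2^{n-2}+n-1, & S=Q_n\setminus\{1\};\\ 1+\sum_{x=1}^{|S|}\sum_{y=1}^{n-|S|}\binom{n-2}{x-1}\binom{n-x-1}{y-1}, & \text{otherwise.}\end{cases}$$ -/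

import Mathlib

namespace TwoSidedAtoms

/-- The set of (left) quotients `w⁻¹L` of a language. -/
def quotients {α : Type} (L : Language α) : Set (Language α) :=
  Set.range L.leftQuotient

/-- The (quotient) complexity `κ(L)`: the number of distinct quotients of `L`. -/
noncomputable def complexity {α : Type} (L : Language α) : ℕ∞ :=
  (quotients L).encard

/-- `L` is a two-sided ideal: `L = Σ* L Σ*`. -/
def IsTwoSidedIdeal {α : Type} (L : Language α) : Prop :=
  L = ⊤ * L * ⊤

/-- The atomic intersection `A_S = ⋂_{i ∈ S} K_i ∩ ⋂_{i ∉ S} (K_i)ᶜ` of a family of languages: the members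
with index in `S` are uncomplemented, the others are complemented. -/
def atomicIntersection {α ι : Type} (K : ι → Language α) (S : Set ι) : Language α :=
  {w | (∀ i ∈ S, w ∈ K i) ∧ ∀ i ∉ S, w ∉ K i}

/-- An atom of `L`: a non-empty atomic intersection of the quotients of `L`. -/
def IsAtomOf {α : Type} (L A : Language α) : Prop :=
  (∃ w, w ∈ A) ∧
    ∃ S : Set (quotients L), A = atomicIntersection (fun K : quotients L => (K : Language α)) S

/-- The state `k` of `Q_n = {1, …, n}`; the set `Q_n` is represented by `Fin n`. -/
def state (n k : ℕ) (h : 1 ≤ k ∧ k ≤ n) : Fin n :=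
  ⟨k - 1, by omega⟩

/-- The unitary transformation `(p → q)`. -/
def unitary {n : ℕ} (p q : Fin n) : Fin n → Fin n :=
  fun i => if i = p then q else i

/-- The transformation `(Q_m → q)`, which sends `1, …, m` to `q` and fixes `m + 1, …, n`. -/
def collapse {n : ℕ} (m : ℕ) (q : Fin n) : Fin n → Fin n :=
  fun i => if i.val + 1 ≤ m then q else i

/-- The cycle `(p, p + 1, …, q)`, for `p ≤ q`. -/
def cycle {n : ℕ} (p q : Fin n) : Fin n → Fin n :=
  fun i => if h : p ≤ i ∧ i < q then ⟨i.val + 1, by omega⟩ else if i = q then p else i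

inductive Letters2
  | a | b

inductive Letters4
  | a | b | c | d

inductive Letters6
  | a | b | c | d | e | f

/-- The alphabet of `D_n`: `{a, b}` for `n = 2`, `{a, b, c, d}` for `n = 3` and
`{a, b, c, d, e, f}` for `n ≥ 4`. -/
def Alphabet : ℕ → Type
  | 2 => Letters2
  | 3 => Letters4
  | _ => Letters6

/-- `D_n` for `n ≥ 4`. -/
def dfaLarge (n : ℕ) (hn : 4 ≤ n) : DFA Letters6 (Fin n) where
  step q x := match x with
    | .a => cycle (state n 2 (by omega)) (state n (n - 1) (by omega)) q
    | .b => Equiv.swap (state n 2 (by omega)) (state n 3 (by omega)) q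
    | .c => unitary (state n (n - 1) (by omega)) (state n 2 (by omega)) q
    | .d => unitary (state n (n - 1) (by omega)) (state n 1 (by omega)) q
    | .e => collapse (n - 1) (state n 2 (by omega)) q
    | .f => unitary (state n 2 (by omega)) (state n n (by omega)) q
  start := state n 1 (by omega)
  accept := {state n n (by omega)}

/-- `D_3`. -/
def dfa3 : DFA Letters4 (Fin 3) where
  step q x := match x with
    | .a => q
    | .b => collapse 2 (state 3 2 (by omega)) q
    | .c => unitary (state 3 2 (by omega)) (state 3 3 (by omega)) q
    | .d => unitary (state 3 2 (by omega)) (state 3 1 (by omega)) q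
  start := state 3 1 (by omega)
  accept := {state 3 3 (by omega)}

/-- `D_2`. -/
def dfa2 : DFA Letters2 (Fin 2) where
  step q x := match x with
    | .a => q
    | .b => collapse 2 (state 2 2 (by omega)) q
  start := state 2 1 (by omega)
  accept := {state 2 2 (by omega)}

/-- The DFA `D_n`, `n ≥ 2`. -/
def dfa : (n : ℕ) → 2 ≤ n → DFA (Alphabet n) (Fin n)
  | 0, h => absurd h (by omega)
  | 1, h => absurd h (by omega)
  | 2, _ => dfa2
  | 3, _ => dfa3
  | n + 4, _ => dfaLarge (n + 4) (by omega)

/-- The bound on the complexity of the atom `A_S` of a two-sided ideal of complexity `n`. -/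
def atomBound (n : ℕ) (hn : 2 ≤ n) (S : Finset (Fin n)) : ℕ :=
  if S = Finset.univ then n
  else if S = Finset.univ \ {state n 1 (by omega)} then 2 ^ (n - 2) + n - 1
  else 1 + ∑ x ∈ Finset.Icc 1 S.card, ∑ y ∈ Finset.Icc 1 (n - S.card),
    (n - 2).choose (x - 1) * (n - x - 1).choose (y - 1)

end TwoSidedAtoms

/-! Write `s` for the initial state and `z` for the final state. No letter moves `z`, and every
letter that moves `s` maps each state either to the image of `s` or to `z`; hence a word accepted
from `s` is accepted from every state, and the language is a two-sided ideal. Apart from this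
constraint the transitions are as rich as possible: words induce every transformation that fixes
`s` and `z`. Therefore `A_S` is non-empty if and only if `S` contains all states, or `z ∈ S` and
`s ∉ S`.

For `S` of the second kind, a word `w` turns `A_S` into the language of the words accepted from each
state of `X = S·w` and from no state of `Y = Sᶜ·w`. This is empty if `X` meets `Y`. If `w` fixes
`s`, then `z ∈ X` and `s ∈ Y`, and all disjoint such pairs with `#X ≤ #S` and `#Y ≤ #Sᶜ` occur. If
`w` moves `s` and the quotient is non-empty, then `X = {z}` and `Y = {s·w}`, and adding `s` to `Y`
does not change the language. Pairs with `z ∈ X` and `s ∈ Y` define distinct non-empty languages, so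
the complexity of `A_S` is a count of pairs; the pairs `({z}, {s, j})` of words that move `s` are
new only when `#Sᶜ = 1`.
-/

namespace TwoSidedAtoms

section Languages

variable {α ι : Type} {L A : Language α} {K : ι → Language α} {S : Set ι} {w : List α}

theorem isTwoSidedIdeal_of_append_mem (h : ∀ v ∈ L, ∀ u w, u ++ v ++ w ∈ L) :
    IsTwoSidedIdeal L := by
  refine le_antisymm (fun v hv => ?_) fun x hx => ?_
  · exact Language.mem_mul.2
      ⟨v, Language.mem_mul.2 ⟨[], trivial, v, hv, rfl⟩, [], trivial, v.append_nil⟩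
  · obtain ⟨_, huv, w, -, rfl⟩ := Language.mem_mul.1 hx
    obtain ⟨u, -, v, hv, rfl⟩ := Language.mem_mul.1 huv
    exact h v hv u w

theorem mem_atomicIntersection : w ∈ atomicIntersection K S ↔ ∀ i, w ∈ K i ↔ i ∈ S :=
  ⟨fun hw i => ⟨fun hi => by_contra fun hS => hw.2 i hS hi, hw.1 i⟩,
    fun hw => ⟨fun i hi => (hw i).2 hi, fun i hS hi => hS ((hw i).1 hi)⟩⟩

theorem atomicIntersection_injOn :
    Set.InjOn (atomicIntersection K) {S | ∃ w, w ∈ atomicIntersection K S} := by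
  rintro S ⟨w, hw⟩ T - hST
  have hw' : w ∈ atomicIntersection K T := hST ▸ hw
  rw [mem_atomicIntersection] at hw hw'
  exact Set.ext fun i => (hw i).symm.trans (hw' i)

theorem atomicIntersection_eq_of_mem {κ : Type} {K' : κ → Language α} {T : Set κ}
    (hK : Set.range K = Set.range K') (hS : w ∈ atomicIntersection K S)
    (hT : w ∈ atomicIntersection K' T) : atomicIntersection K S = atomicIntersection K' T := by
  have mem_iff : ∀ {ι : Type} {K : ι → Language α} {S : Set ι}, w ∈ atomicIntersection K S →
      ∀ v, v ∈ atomicIntersection K S ↔ ∀ B ∈ Set.range K, v ∈ B ↔ w ∈ B := by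
    intro ι K S hw v
    simp only [mem_atomicIntersection] at hw
    simp only [mem_atomicIntersection, Set.forall_mem_range, hw]
  ext v
  rw [mem_iff hS, mem_iff hT, hK]

theorem isAtomOf_iff_of_range_eq (hK : Set.range K = quotients L) :
    IsAtomOf L A ↔ (∃ w, w ∈ A) ∧ ∃ S : Set ι, A = atomicIntersection K S := by
  refine and_congr_right fun ⟨w, hw⟩ => ⟨?_, ?_⟩
  · rintro ⟨T, rfl⟩
    exact ⟨{i | w ∈ K i}, atomicIntersection_eq_of_mem (by rw [hK, Subtype.range_coe]) hw
      (mem_atomicIntersection.2 fun _ => Iff.rfl)⟩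
  · rintro ⟨S, rfl⟩
    exact ⟨{B | w ∈ (B : Language α)}, atomicIntersection_eq_of_mem (by rw [hK, Subtype.range_coe])
      hw (mem_atomicIntersection.2 fun _ => Iff.rfl)⟩

theorem encard_atoms_of_range_eq (hK : Set.range K = quotients L) :
    {A | IsAtomOf L A}.encard = {S | ∃ w, w ∈ atomicIntersection K S}.encard := by
  rw [← atomicIntersection_injOn.encard_image]
  congr 1
  ext A
  rw [Set.mem_ofPred_eq, isAtomOf_iff_of_range_eq hK]
  constructor
  · rintro ⟨hA, S, rfl⟩
    exact ⟨S, hA, rfl⟩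
  · rintro ⟨S, hS, rfl⟩
    exact ⟨hS, S, rfl⟩

end Languages

section Automata

variable {α Q : Type} {M : DFA α Q}

theorem range_acceptsFrom (hM : Function.Surjective M.eval) :
    Set.range M.acceptsFrom = quotients M.accepts := by
  rw [quotients, Language.leftQuotient_accepts, hM.range_comp]

theorem complexity_accepts (hM : Function.Surjective M.eval)
    (hinj : Function.Injective M.acceptsFrom) : complexity M.accepts = ENat.card Q := by
  rw [complexity, ← range_acceptsFrom hM, ← Set.image_univ, hinj.encard_image, Set.encard_univ]

theorem append_mem_acceptsFrom {q : Q} {w v : List α} :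
    w ++ v ∈ M.acceptsFrom q ↔ v ∈ M.acceptsFrom (M.evalFrom q w) := by
  rw [M.mem_acceptsFrom, M.evalFrom_of_append, M.mem_acceptsFrom]

/-- The words accepted from each state of `X` and from no state of `Y`. All quotients of an atomic
intersection have this form. -/
def pairLanguage (M : DFA α Q) (X Y : Set Q) : Language α :=
  {v | (∀ q ∈ X, v ∈ M.acceptsFrom q) ∧ ∀ q ∈ Y, v ∉ M.acceptsFrom q}

theorem mem_pairLanguage {X Y : Set Q} {v : List α} : v ∈ pairLanguage M X Y ↔
    (∀ q ∈ X, v ∈ M.acceptsFrom q) ∧ ∀ q ∈ Y, v ∉ M.acceptsFrom q :=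
  Iff.rfl

theorem pairLanguage_anti {X X' Y Y' : Set Q} (hX : X' ⊆ X) (hY : Y' ⊆ Y) :
    pairLanguage M X Y ≤ pairLanguage M X' Y' :=
  fun _ hv => ⟨fun q hq => hv.1 q (hX hq), fun q hq => hv.2 q (hY hq)⟩

theorem mem_pairLanguage_iff_of_mem_atomicIntersection {X Y Z : Set Q} {v : List α}
    (hv : v ∈ atomicIntersection M.acceptsFrom Z) :
    v ∈ pairLanguage M X Y ↔ X ⊆ Z ∧ Disjoint Y Z := by
  rw [mem_atomicIntersection] at hv
  simp only [mem_pairLanguage, hv, Set.disjoint_left, Set.subset_def]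

theorem pairLanguage_eq_bot_of_not_disjoint {X Y : Set Q} (h : ¬ Disjoint X Y) :
    pairLanguage M X Y = ⊥ := by
  obtain ⟨q, hX, hY⟩ := Set.not_disjoint_iff.1 h
  exact le_bot_iff.1 fun v hv => hv.2 q hY (hv.1 q hX)

theorem leftQuotient_atomicIntersection (S : Set Q) (w : List α) :
    (atomicIntersection M.acceptsFrom S).leftQuotient w =
      pairLanguage M ((M.evalFrom · w) '' S) ((M.evalFrom · w) '' Sᶜ) := by
  ext v
  simp only [mem_pairLanguage, Set.forall_mem_image, ← append_mem_acceptsFrom]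
  rfl

/-- The transformations of the states of `M` induced by words. Composition in `Function.End` is
from right to left, hence `w ++ v` acts as the action of `v` times that of `w`. -/
def transitionMonoid (M : DFA α Q) : Submonoid (Function.End Q) where
  carrier := {t | ∃ w, ∀ q, M.evalFrom q w = t q}
  one_mem' := ⟨[], fun _ => rfl⟩
  mul_mem' := by
    rintro t u ⟨v, hv⟩ ⟨w, hw⟩
    exact ⟨w ++ v, fun q => by rw [M.evalFrom_of_append, hw, hv]; rfl⟩

theorem step_mem_transitionMonoid (M : DFA α Q) (x : α) : (M.step · x) ∈ transitionMonoid M :=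
  ⟨[x], fun _ => rfl⟩

theorem evalFrom_eq_of_forall_step_eq {z : Q} (hz : ∀ x, M.step z x = z) (w : List α) :
    M.evalFrom z w = z := by
  induction w with
  | nil => rfl
  | cons x w ih => rw [M.evalFrom_cons, hz, ih]

end Automata

section Transformations

open Equiv

variable {ι : Type*} [DecidableEq ι]

theorem swap_mem_of_sameCycle [Finite ι] {P : Submonoid (Perm ι)} {σ : Perm ι} {a i j : ι}
    (hσ : σ ∈ P) (hswap : swap a (σ a) ∈ P) (hi : σ.SameCycle a i) (hj : σ.SameCycle a j) :
    swap i j ∈ P := by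
  have zpow_mem (k : ℤ) : σ ^ k ∈ P := Submonoid.powers_le.2 hσ
    (mem_powers_iff_mem_zpowers.2 (zpow_mem (Subgroup.mem_zpowers σ) k))
  have swap_pow_mem (k : ℕ) : swap a ((σ ^ k) a) ∈ P := by
    induction k with
    | zero =>
      rw [pow_zero, Perm.one_apply, swap_self]
      exact P.one_mem
    | succ k ih =>
      have adjacent : swap ((σ ^ k) a) ((σ ^ (k + 1)) a) ∈ P := by
        rw [pow_succ, Perm.mul_apply, swap_apply_apply, ← zpow_natCast, ← zpow_neg]
        exact P.mul_mem (P.mul_mem (zpow_mem _) hswap) (zpow_mem _)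
      exact SubmonoidClass.swap_mem_trans P ih adjacent
  have swap_mem {b : ι} (hb : σ.SameCycle a b) : swap a b ∈ P := by
    obtain ⟨k, -, -, rfl⟩ := hb.exists_pow_eq''
    exact swap_pow_mem k
  exact SubmonoidClass.swap_mem_trans P (swap_comm a i ▸ swap_mem hi) (swap_mem hj)

variable {T : Submonoid (Function.End ι)} {P : Set ι} {p q i j : ι}

theorem update_swap_apply_mem (hswap : ⇑(swap i j) ∈ T) (h : Function.update id p q ∈ T) :
    Function.update id (swap i j p) (swap i j q) ∈ T := by
  have conj : Function.update id (swap i j p) (swap i j q) =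
      swap i j ∘ Function.update id p q ∘ swap i j := by
    rw [Function.update_comp_equiv, Function.comp_update, Function.id_comp, ← Perm.coe_mul,
      swap_mul_self, symm_swap, Perm.coe_one]
  rw [conj]
  exact T.mul_mem hswap (T.mul_mem h hswap)

theorem update_mem_of_swap_mem_of_notMem (hswap : ∀ i ∈ P, ∀ j ∈ P, ⇑(swap i j) ∈ T)
    (hp : p ∈ P) (hq : q ∉ P) (h : Function.update id p q ∈ T) (hi : i ∈ P) :
    Function.update id i q ∈ T := by
  simpa only [swap_apply_left, swap_apply_of_ne_of_ne (ne_of_mem_of_not_mem hp hq).symm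
    (ne_of_mem_of_not_mem hi hq).symm] using update_swap_apply_mem (hswap p hp i hi) h

theorem update_mem_of_swap_mem (hswap : ∀ i ∈ P, ∀ j ∈ P, ⇑(swap i j) ∈ T)
    (hp : p ∈ P) (hq : q ∈ P) (hpq : p ≠ q) (h : Function.update id p q ∈ T)
    (hi : i ∈ P) (hj : j ∈ P) (hij : i ≠ j) : Function.update id i j ∈ T := by
  obtain ⟨k, hk, hik, update_ik⟩ : ∃ k ∈ P, i ≠ k ∧ Function.update id i k ∈ T := by
    refine ⟨swap p i q, ?_, fun hik => hpq ?_, by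
      simpa only [swap_apply_left] using update_swap_apply_mem (hswap p hp i hi) h⟩
    · obtain rfl | hqi := eq_or_ne q i
      · rwa [swap_apply_right]
      · rwa [swap_apply_of_ne_of_ne hpq.symm hqi]
    · exact (swap p i).injective ((swap_apply_left p i).trans hik)
  simpa only [swap_apply_left, swap_apply_of_ne_of_ne hik hij] using
    update_swap_apply_mem (hswap k hk j hj) update_ik

theorem mem_of_swap_mem_of_update_mem [Finite ι] (hswap : ∀ i ∈ P, ∀ j ∈ P, ⇑(swap i j) ∈ T)
    (hupdate : ∀ i ∈ P, ∀ j, i ≠ j → Function.update id i j ∈ T) {t : ι → ι}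
    (ht : ∀ i ∉ P, t i = i) : t ∈ T := by
  induction hF : Function.fixedPoints t using WellFoundedGT.induction generalizing t with
  | ind F ih =>
  subst hF
  by_cases hid : ∀ i, t i = i
  · exact funext hid ▸ T.one_mem
  obtain ⟨i, hi⟩ := not_forall.1 hid
  have hiP : i ∈ P := by_contra fun h => hi (ht i h)
  -- Split off a swap if `i` is a value of `t` and an update otherwise: what remains of `t`
  -- fixes one more point.
  have mem_of_fixes_more {u : ι → ι} {x : ι} (hu : ∀ y, t y = y → u y = y) (htx : t x ≠ x)
      (hux : u x = x) : u ∈ T :=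
    ih _ ((Set.ssubset_iff_of_subset hu).2 ⟨x, hux, htx⟩) (fun y hy => hu y (ht y hy)) rfl
  by_cases hrange : ∃ x, t x = i
  · obtain ⟨x, rfl⟩ := hrange
    have htx : t x ≠ x := fun h => hi (congrArg t h)
    have fixes (y : ι) (hy : t y = y) : swap (t x) x (t y) = y := by
      rw [hy, swap_apply_of_ne_of_ne]
      · rintro rfl
        exact hi hy
      · rintro rfl
        exact htx hy
    have hxP : x ∈ P := by_contra fun h => htx (ht x h)
    have factor : t = swap (t x) x ∘ swap (t x) x ∘ t :=
      funext fun y => (swap_apply_self _ _ _).symm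
    rw [factor]
    exact T.mul_mem (hswap _ hiP _ hxP)
      (mem_of_fixes_more (u := swap (t x) x ∘ t) fixes htx (swap_apply_left _ _))
  · have factor : t = Function.update id i (t i) ∘ Function.update t i i := by
      funext y
      obtain rfl | hy := eq_or_ne y i
      · simp only [Function.comp_apply, Function.update_self]
      · rw [Function.comp_apply, Function.update_of_ne hy,
          Function.update_of_ne fun h => hrange ⟨y, h⟩, id]
    rw [factor]
    refine T.mul_mem (hupdate i hiP _ (Ne.symm hi)) (mem_of_fixes_more (fun y hy => ?_) hi
      (Function.update_self ..))
    obtain rfl | hyi := eq_or_ne y i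
    · exact Function.update_self ..
    · rwa [Function.update_of_ne hyi]

end Transformations

open Finset

section Pairs

variable {Q : Type*} {s z : Q}

theorem exists_map_image_eq {κ : Type*} [DecidableEq κ] {A : Finset Q} {B : Finset κ} {a : Q}
    {b : κ} (ha : a ∈ A) (hb : b ∈ B) (hcard : #B ≤ #A) :
    ∃ f : Q → κ, f a = b ∧ A.image f = B := by
  classical
  have card_erase_le : Fintype.card (B.erase b) ≤ Fintype.card (A.erase a) := by
    simp only [Fintype.card_coe, card_erase_of_mem ha, card_erase_of_mem hb]
    lia
  obtain ⟨g⟩ := Function.Embedding.nonempty_of_card_le card_erase_le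
  let f : Q → κ := Function.extend (fun y => (g y : Q)) (fun y => (y : κ)) fun _ => b
  have f_apply (y : B.erase b) : f (g y) = y :=
    (Subtype.val_injective.comp g.injective).extend_apply _ _ y
  have f_eq_of_forall_ne {x : Q} (hx : ¬∃ y, (g y : Q) = x) : f x = b :=
    Function.extend_apply' _ _ _ hx
  have f_a : f a = b := f_eq_of_forall_ne fun ⟨y, hy⟩ => (mem_erase.1 (g y).2).1 hy
  refine ⟨f, f_a, Subset.antisymm (image_subset_iff.2 fun x _ => ?_) fun y hy => mem_image.2 ?_⟩
  · by_cases hx : ∃ y, (g y : Q) = x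
    · obtain ⟨y, rfl⟩ := hx
      exact f_apply y ▸ mem_of_mem_erase y.2
    · exact f_eq_of_forall_ne hx ▸ hb
  · obtain rfl | hyb := eq_or_ne y b
    · exact ⟨a, ha, f_a⟩
    · exact ⟨_, mem_of_mem_erase (g ⟨y, mem_erase.2 ⟨hyb, hy⟩⟩).2, f_apply _⟩

theorem encard_Icc_singleton_compl_singleton [Fintype Q] (hsz : s ≠ z) :
    (Set.Icc {z} {s}ᶜ : Set (Set Q)).encard = (2 ^ (Fintype.card Q - 2) : ℕ) := by
  classical
  have image_eq : Fintype.finsetOrderIsoSet '' (Icc {z} {s}ᶜ : Finset (Finset Q)) =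
      Set.Icc ({z} : Set Q) {s}ᶜ := by
    rw [coe_Icc, OrderIso.image_Icc]
    change Set.Icc (({z} : Finset Q) : Set Q) (({s}ᶜ : Finset Q) : Set Q) = _
    rw [coe_singleton, coe_compl, coe_singleton]
  rw [← image_eq, Fintype.finsetOrderIsoSet.injective.encard_image,
    Set.encard_coe_eq_coe_finsetCard, card_Icc_finset (by simpa using hsz), card_compl,
    card_singleton, card_singleton, Nat.sub_sub]

variable [DecidableEq Q]

theorem card_filter_disjoint_powersetCard (U : Finset Q) (x y : ℕ) :
    #{p ∈ U.powersetCard x ×ˢ U.powersetCard y | Disjoint p.1 p.2} =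
      (#U).choose x * (#U - x).choose y := by
  have fiber (X : Finset Q) :
      {Y ∈ U.powersetCard y | Disjoint X Y} = (U \ X).powersetCard y := by
    ext Y
    simp only [mem_filter, mem_powersetCard, subset_sdiff, disjoint_comm (a := X)]
    tauto
  rw [card_filter, sum_product, ← card_powersetCard, ← smul_eq_mul, ← sum_const]
  refine sum_congr rfl fun X hX => ?_
  rw [← card_filter, fiber X, card_powersetCard, card_sdiff_of_subset (mem_powersetCard.1 hX).1,
    (mem_powersetCard.1 hX).2]

/-- Pairs of disjoint sets of states, the first containing `z` and the second containing `s`. With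
`s` the initial state and `z` the final sink of a witness, `pairLanguage` maps them injectively to
non-empty languages. -/
def IsNormalPair (s z : Q) (p : Finset Q × Finset Q) : Prop :=
  z ∈ p.1 ∧ s ∈ p.2 ∧ Disjoint p.1 p.2

instance (s z : Q) : DecidablePred (IsNormalPair s z) := fun _ =>
  inferInstanceAs (Decidable (_ ∧ _ ∧ _))

variable [Fintype Q]

/-- The normal pairs whose components have at most `a` and at most `b` elements. -/
def normalPairs (s z : Q) (a b : ℕ) : Finset (Finset Q × Finset Q) :=
  {p | IsNormalPair s z p ∧ #p.1 ≤ a ∧ #p.2 ≤ b}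

/-- The pairs that arise from words moving the state `s`: such words leave at most one state
`j` besides `z`. -/
def collapsedPairs (s z : Q) : Finset (Finset Q × Finset Q) :=
  ({s, z} : Finset Q)ᶜ.image fun j => ({z}, {s, j})

theorem mem_normalPairs {a b : ℕ} {p : Finset Q × Finset Q} :
    p ∈ normalPairs s z a b ↔ IsNormalPair s z p ∧ #p.1 ≤ a ∧ #p.2 ≤ b := by
  simp only [normalPairs, mem_filter_univ]

theorem isNormalPair_of_mem_collapsedPairs (hsz : s ≠ z) {p : Finset Q × Finset Q}
    (hp : p ∈ collapsedPairs s z) : IsNormalPair s z p := by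
  obtain ⟨j, hj, rfl⟩ := mem_image.1 hp
  simp only [mem_compl, mem_insert, mem_singleton, not_or] at hj
  simp [IsNormalPair, hsz.symm, Ne.symm hj.2]

theorem card_snd_of_mem_collapsedPairs {p : Finset Q × Finset Q}
    (hp : p ∈ collapsedPairs s z) : #p.2 = 2 := by
  obtain ⟨j, hj, rfl⟩ := mem_image.1 hp
  simp only [mem_compl, mem_insert, mem_singleton, not_or] at hj
  exact card_pair (Ne.symm hj.1)

theorem collapsedPairs_subset_normalPairs (hsz : s ≠ z) {a b : ℕ} (ha : 1 ≤ a) (hb : 2 ≤ b) :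
    collapsedPairs s z ⊆ normalPairs s z a b := by
  intro p hp
  refine mem_normalPairs.2 ⟨isNormalPair_of_mem_collapsedPairs hsz hp, ?_,
    (card_snd_of_mem_collapsedPairs hp).trans_le hb⟩
  obtain ⟨j, -, rfl⟩ := mem_image.1 hp
  exact (card_singleton z).trans_le ha

theorem disjoint_normalPairs_collapsedPairs (a : ℕ) :
    Disjoint (normalPairs s z a 1) (collapsedPairs s z) := by
  refine disjoint_left.2 fun p hp hp' => ?_
  have := (mem_normalPairs.1 hp).2.2
  have := card_snd_of_mem_collapsedPairs hp'
  lia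

theorem card_collapsedPairs (hsz : s ≠ z) : #(collapsedPairs s z) = Fintype.card Q - 2 := by
  rw [collapsedPairs, card_image_of_injOn, card_compl, card_pair hsz]
  intro i hi j _ hij
  simp only [coe_compl, Set.mem_compl_iff, mem_coe, mem_insert, mem_singleton, not_or] at hi
  have snd_eq : ({s, i} : Finset Q) = {s, j} := congrArg Prod.snd hij
  have i_mem : i ∈ ({s, j} : Finset Q) := snd_eq ▸ mem_insert_of_mem (mem_singleton_self i)
  simpa only [mem_insert, hi.1, false_or, mem_singleton] using i_mem

theorem card_filter_isNormalPair (hsz : s ≠ z) (x y : ℕ) :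
    #{p : Finset Q × Finset Q | IsNormalPair s z p ∧ #p.1 = x + 1 ∧ #p.2 = y + 1} =
      (Fintype.card Q - 2).choose x * (Fintype.card Q - 2 - x).choose y := by
  have card_middle : #({s, z} : Finset Q)ᶜ = Fintype.card Q - 2 := by
    rw [card_compl, card_pair hsz]
  have subset_middle_iff (X : Finset Q) : X ⊆ {s, z}ᶜ ↔ s ∉ X ∧ z ∉ X := by
    rw [subset_compl_comm, insert_subset_iff, singleton_subset_iff, mem_compl, mem_compl]
  rw [← card_middle, ← card_filter_disjoint_powersetCard]
  refine card_nbij' (fun p => (p.1.erase z, p.2.erase s)) (fun p => (insert z p.1, insert s p.2))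
    ?_ ?_ ?_ ?_
  · rintro ⟨X, Y⟩ h
    obtain ⟨⟨hz, hs, hXY⟩, hX, hY⟩ := (mem_filter.1 h).2
    simp only [coe_filter, mem_product, mem_powersetCard, subset_middle_iff, Set.mem_ofPred_eq]
    grind [disjoint_left]
  · rintro ⟨X, Y⟩ h
    simp only [coe_filter, mem_product, mem_powersetCard, subset_middle_iff, Set.mem_ofPred_eq] at h
    obtain ⟨⟨⟨⟨hsX, hzX⟩, hX⟩, ⟨⟨hsY, hzY⟩, hY⟩⟩, hXY⟩ := h
    refine mem_coe.2 (mem_filter_univ _ |>.2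
      ⟨⟨mem_insert_self .., mem_insert_self .., ?_⟩, ?_, ?_⟩)
    · simp [hsz, hsX, hzY, hXY]
    · rw [card_insert_of_notMem hzX, hX]
    · rw [card_insert_of_notMem hsY, hY]
  · rintro ⟨X, Y⟩ h
    obtain ⟨⟨hz, hs, -⟩, -⟩ := (mem_filter.1 h).2
    exact Prod.ext (insert_erase hz) (insert_erase hs)
  · rintro ⟨X, Y⟩ h
    simp only [coe_filter, mem_product, mem_powersetCard, subset_middle_iff, Set.mem_ofPred_eq] at h
    exact Prod.ext (erase_insert h.1.1.1.2) (erase_insert h.1.2.1.1)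

theorem card_normalPairs (hsz : s ≠ z) (a b : ℕ) :
    #(normalPairs s z a b) = ∑ x ∈ Icc 1 a, ∑ y ∈ Icc 1 b,
      (Fintype.card Q - 2).choose (x - 1) * (Fintype.card Q - x - 1).choose (y - 1) := by
  have card_mem_box {p : Finset Q × Finset Q} (hp : p ∈ normalPairs s z a b) :
      (#p.1, #p.2) ∈ Icc 1 a ×ˢ Icc 1 b := by
    obtain ⟨⟨hz, hs, -⟩, ha, hb⟩ := mem_normalPairs.1 hp
    exact mem_product.2 ⟨mem_Icc.2 ⟨card_pos.2 ⟨z, hz⟩, ha⟩, mem_Icc.2 ⟨card_pos.2 ⟨s, hs⟩, hb⟩⟩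
  rw [card_eq_sum_card_fiberwise fun p hp => card_mem_box hp, sum_product]
  refine sum_congr rfl fun x hx => sum_congr rfl fun y hy => ?_
  rw [mem_Icc] at hx hy
  obtain ⟨x, rfl⟩ := Nat.exists_eq_add_of_le' hx.1
  obtain ⟨y, rfl⟩ := Nat.exists_eq_add_of_le' hy.1
  rw [Nat.add_sub_cancel, Nat.add_sub_cancel, show Fintype.card Q - (x + 1) - 1 =
    Fintype.card Q - 2 - x by lia, ← card_filter_isNormalPair hsz]
  congr 1
  ext p
  simp only [mem_filter, mem_normalPairs, Prod.mk.injEq, mem_univ, true_and]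
  constructor
  · exact fun ⟨⟨hp, _⟩, hcard⟩ => ⟨hp, hcard⟩
  · exact fun ⟨hp, hcard⟩ => ⟨⟨hp, hcard.1.trans_le hx.2, hcard.2.trans_le hy.2⟩, hcard⟩

theorem card_normalPairs_one (hsz : s ≠ z) :
    #(normalPairs s z (Fintype.card Q - 1) 1) = 2 ^ (Fintype.card Q - 2) := by
  have two_le_card : 2 ≤ Fintype.card Q := card_pair hsz ▸ card_le_univ {s, z}
  obtain ⟨m, hm⟩ := Nat.exists_eq_add_of_le' two_le_card
  simp only [card_normalPairs hsz, hm, Icc_self, sum_singleton, Nat.sub_self, Nat.choose_zero_right,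
    mul_one]
  rw [← Ico_add_one_right_eq_Icc, sum_Ico_eq_sum_range, ← Nat.sum_range_choose]
  exact sum_congr rfl fun k _ => by rw [Nat.add_sub_cancel_left, Nat.add_sub_cancel]

end Pairs

/-- A DFA with single final state `z` whose transitions force its language to be a two-sided ideal
(`step_sink`, `step_start`) but which is otherwise as rich as these constraints allow: words induce
every transformation that fixes `z` and the initial state, and can send all states but `z` to any
given state. -/
structure IsIdealWitness {α Q : Type} (M : DFA α Q) (z : Q) : Prop where
  accept_eq : M.accept = {z}
  start_ne : M.start ≠ z
  step_sink : ∀ x, M.step z x = z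
  step_start : ∀ x, M.step M.start x = M.start ∨
    ∀ q, M.step q x = M.step M.start x ∨ M.step q x = z
  mem_transitionMonoid : ∀ t : Q → Q, t M.start = M.start → t z = z → t ∈ transitionMonoid M
  exists_collapse : ∀ j, ∃ w, ∀ q ≠ z, M.evalFrom q w = j

namespace IsIdealWitness

variable {α Q : Type} {M : DFA α Q} {z : Q}

theorem evalFrom_sink (h : IsIdealWitness M z) (w : List α) : M.evalFrom z w = z :=
  evalFrom_eq_of_forall_step_eq h.step_sink w

theorem evalFrom_start (h : IsIdealWitness M z) (w : List α) : M.evalFrom M.start w = M.start ∨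
    ∀ q, M.evalFrom q w = M.evalFrom M.start w ∨ M.evalFrom q w = z := by
  induction w with
  | nil => exact Or.inl rfl
  | cons x w ih =>
    simp only [M.evalFrom_cons]
    obtain hfix | hmove := h.step_start x
    · rw [hfix]
      exact ih.imp_right fun hw q => hw (M.step q x)
    · refine Or.inr fun q => (hmove q).imp (fun hq => by rw [hq]) fun hq => ?_
      rw [hq, h.evalFrom_sink]

theorem mem_acceptsFrom (h : IsIdealWitness M z) {q : Q} {w : List α} :
    w ∈ M.acceptsFrom q ↔ M.evalFrom q w = z := by
  rw [M.mem_acceptsFrom, h.accept_eq, Set.mem_singleton_iff]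

theorem mem_acceptsFrom_of_mem_accepts (h : IsIdealWitness M z) {w : List α} (hw : w ∈ M.accepts)
    (q : Q) : w ∈ M.acceptsFrom q := by
  have hw' : M.evalFrom M.start w = z := h.mem_acceptsFrom.1 hw
  obtain hfix | hmove := h.evalFrom_start w
  · exact absurd (hfix.symm.trans hw') h.start_ne
  · exact h.mem_acceptsFrom.2 ((hmove q).elim (·.trans hw') id)

theorem isTwoSidedIdeal (h : IsIdealWitness M z) : IsTwoSidedIdeal M.accepts := by
  refine isTwoSidedIdeal_of_append_mem fun v hv u w => ?_
  have huv : M.evalFrom M.start (u ++ v) = z :=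
    h.mem_acceptsFrom.1 (append_mem_acceptsFrom.2 (h.mem_acceptsFrom_of_mem_accepts hv _))
  exact h.mem_acceptsFrom.2 (by rw [M.evalFrom_of_append, huv, h.evalFrom_sink])

theorem surjective_eval (h : IsIdealWitness M z) : Function.Surjective M.eval := fun j =>
  (h.exists_collapse j).imp fun _ hw => hw M.start h.start_ne

theorem exists_evalFrom_eq_ite (h : IsIdealWitness M z) {S : Set Q} [DecidablePred (· ∈ S)]
    (hz : z ∈ S) (hs : M.start ∉ S) : ∃ w, ∀ q, M.evalFrom q w = if q ∈ S then z else q :=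
  h.mem_transitionMonoid _ (if_neg hs) (if_pos hz)

theorem nonempty_atomicIntersection_iff (h : IsIdealWitness M z) {S : Set Q} :
    (∃ w, w ∈ atomicIntersection M.acceptsFrom S) ↔ S = Set.univ ∨ z ∈ S ∧ M.start ∉ S := by
  classical
  simp only [mem_atomicIntersection]
  constructor
  · rintro ⟨w, hw⟩
    by_cases hs : M.start ∈ S
    · exact Or.inl (Set.eq_univ_of_forall fun q =>
        (hw q).1 (h.mem_acceptsFrom_of_mem_accepts ((hw _).2 hs) q))
    · exact Or.inr ⟨(hw z).1 (h.mem_acceptsFrom.2 (h.evalFrom_sink w)), hs⟩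
  · rintro (rfl | ⟨hz, hs⟩)
    · obtain ⟨w, hw⟩ := h.surjective_eval z
      exact ⟨w, fun q => iff_of_true
        (h.mem_acceptsFrom_of_mem_accepts (h.mem_acceptsFrom.2 hw) q) (Set.mem_univ q)⟩
    · obtain ⟨w, hw⟩ := h.exists_evalFrom_eq_ite hz hs
      refine ⟨w, fun q => ?_⟩
      rw [h.mem_acceptsFrom, hw, ite_eq_left_iff]
      exact ⟨fun hq => by_contra fun hqS => hqS (hq hqS ▸ hz), fun hq hqS => absurd hq hqS⟩

theorem acceptsFrom_injective (h : IsIdealWitness M z) : Function.Injective M.acceptsFrom := by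
  have not_le {p q : Q} (hpq : p ≠ q) (hp : p ≠ M.start) (hq : q ≠ z) :
      ¬ M.acceptsFrom p ≤ M.acceptsFrom q := by
    intro hle
    obtain ⟨w, hw⟩ := h.nonempty_atomicIntersection_iff (S := {p, z}) |>.2
      (Or.inr ⟨by simp, by simp [hp.symm, h.start_ne]⟩)
    rw [mem_atomicIntersection] at hw
    simpa [hpq.symm, hq] using (hw q).1 (hle ((hw p).2 (Set.mem_insert p _)))
  intro p q heq
  by_contra hpq
  by_cases hpq' : p = M.start ∨ q = z
  · refine not_le (Ne.symm hpq) ?_ ?_ heq.ge <;> grind [h.start_ne]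
  · exact not_le hpq (fun hp => hpq' (Or.inl hp)) (fun hq => hpq' (Or.inr hq)) heq.le

theorem pairLanguage_insert_start (h : IsIdealWitness M z) (X : Set Q) (j : Q) :
    pairLanguage M X {M.start, j} = pairLanguage M X {j} := by
  ext v
  simp only [mem_pairLanguage, Set.mem_insert_iff, Set.mem_singleton_iff, forall_eq_or_imp,
    forall_eq, and_congr_right_iff, and_iff_right_iff_imp]
  exact fun _ hj hs => hj (h.mem_acceptsFrom_of_mem_accepts hs j)

theorem pairLanguage_le_iff (h : IsIdealWitness M z) {X Y X' Y' : Set Q} (hz : z ∈ X)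
    (hs : M.start ∈ Y) (hXY : Disjoint X Y) :
    pairLanguage M X Y ≤ pairLanguage M X' Y' ↔ X' ⊆ X ∧ Y' ⊆ Y := by
  refine ⟨fun hle => ?_, fun hsub => pairLanguage_anti hsub.1 hsub.2⟩
  -- The words of the atoms `A_X` and `A_Yᶜ` detect all of `X` and `Y`.
  have subset_of_between {Z : Set Q} (hXZ : X ⊆ Z) (hYZ : Disjoint Y Z) :
      X' ⊆ Z ∧ Disjoint Y' Z := by
    obtain ⟨v, hv⟩ := h.nonempty_atomicIntersection_iff.2
      (Or.inr ⟨hXZ hz, Set.disjoint_left.1 hYZ hs⟩)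
    rw [← mem_pairLanguage_iff_of_mem_atomicIntersection hv]
    exact hle ((mem_pairLanguage_iff_of_mem_atomicIntersection hv).2 ⟨hXZ, hYZ⟩)
  exact ⟨(subset_of_between subset_rfl hXY.symm).1, Set.disjoint_compl_right_iff_subset.1
    (subset_of_between (Set.subset_compl_iff_disjoint_right.2 hXY) disjoint_compl_right).2⟩

theorem pairLanguage_injOn (h : IsIdealWitness M z) :
    Set.InjOn (fun p : Finset Q × Finset Q => pairLanguage M p.1 p.2)
      {p | IsNormalPair M.start z p} := by
  have subset_of_le {p r : Finset Q × Finset Q} (hp : IsNormalPair M.start z p)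
      (hle : pairLanguage M p.1 p.2 ≤ pairLanguage M r.1 r.2) : r.1 ⊆ p.1 ∧ r.2 ⊆ p.2 := by
    simpa only [coe_subset] using
      (h.pairLanguage_le_iff hp.1 hp.2.1 (disjoint_coe.2 hp.2.2)).1 hle
  intro p hp r hr heq
  have hrp := subset_of_le hp heq.le
  have hpr := subset_of_le hr heq.ge
  exact Prod.ext (hpr.1.antisymm hrp.1) (hpr.2.antisymm hrp.2)

theorem pairLanguage_ne_bot (h : IsIdealWitness M z) {X Y : Set Q} (hz : z ∈ X)
    (hs : M.start ∈ Y) (hXY : Disjoint X Y) : pairLanguage M X Y ≠ ⊥ := by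
  intro hbot
  have hle : pairLanguage M X Y ≤ pairLanguage M X Set.univ := hbot ▸ bot_le
  exact Set.disjoint_left.1 hXY hz
    (((h.pairLanguage_le_iff hz hs hXY).1 hle).2 (Set.mem_univ z))

section Quotients

variable {S : Set Q}

theorem pairLanguage_singleton_mem_quotients (h : IsIdealWitness M z) (hz : z ∈ S)
    (hs : M.start ∉ S) (j : Q) :
    pairLanguage M {z} {j} ∈ quotients (atomicIntersection M.acceptsFrom S) := by
  classical
  obtain ⟨u, hu⟩ := h.exists_evalFrom_eq_ite hz hs
  obtain ⟨v, hv⟩ := h.exists_collapse j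
  have eval_mem {q : Q} (hq : q ∈ S) : M.evalFrom q (u ++ v) = z := by
    rw [M.evalFrom_of_append, hu, if_pos hq, h.evalFrom_sink]
  have eval_notMem {q : Q} (hq : q ∈ Sᶜ) : M.evalFrom q (u ++ v) = j := by
    rw [M.evalFrom_of_append, hu, if_neg hq, hv q fun hqz => hq (hqz ▸ hz)]
  refine ⟨u ++ v, ?_⟩
  rw [leftQuotient_atomicIntersection, Set.image_congr fun q hq => eval_mem hq,
    Set.image_congr fun q hq => eval_notMem hq, Set.Nonempty.image_const ⟨z, hz⟩,
    Set.Nonempty.image_const ⟨M.start, hs⟩]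

theorem leftQuotient_eq_of_evalFrom_start_ne (h : IsIdealWitness M z) (hz : z ∈ S)
    (hs : M.start ∉ S) {w : List α} (hw : M.evalFrom M.start w ≠ M.start)
    (hdisj : Disjoint ((M.evalFrom · w) '' S) ((M.evalFrom · w) '' Sᶜ)) :
    (atomicIntersection M.acceptsFrom S).leftQuotient w =
      pairLanguage M {z} {M.evalFrom M.start w} := by
  have hmove := (h.evalFrom_start w).resolve_left hw
  have z_mem : z ∈ (M.evalFrom · w) '' S := ⟨z, hz, h.evalFrom_sink w⟩
  have start_mem : M.evalFrom M.start w ∈ (M.evalFrom · w) '' Sᶜ := ⟨M.start, hs, rfl⟩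
  have image_eq : (M.evalFrom · w) '' S = {z} :=
    Set.eq_singleton_iff_unique_mem.2 ⟨z_mem, Set.forall_mem_image.2 fun q hq =>
      (hmove q).resolve_left fun hq' =>
        hdisj.notMem_of_mem_left (Set.mem_image_of_mem _ hq) (hq' ▸ start_mem)⟩
  have image_compl_eq : (M.evalFrom · w) '' Sᶜ = {M.evalFrom M.start w} :=
    Set.eq_singleton_iff_unique_mem.2 ⟨start_mem, Set.forall_mem_image.2 fun q hq =>
      (hmove q).resolve_right fun hq' =>
        hdisj.notMem_of_mem_left z_mem ⟨q, hq, hq'⟩⟩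
  rw [leftQuotient_atomicIntersection, image_eq, image_compl_eq]

end Quotients

variable [Fintype Q]

theorem encard_atoms (h : IsIdealWitness M z) :
    {A | IsAtomOf M.accepts A}.encard = ((2 ^ (Fintype.card Q - 2) + 1 : ℕ) : ℕ∞) := by
  classical
  have nonempty_eq : {S | ∃ w, w ∈ atomicIntersection M.acceptsFrom S} =
      insert Set.univ (Set.Icc {z} {M.start}ᶜ) := by
    ext S
    simp only [Set.mem_ofPred_eq, h.nonempty_atomicIntersection_iff, Set.mem_insert_iff,
      Set.mem_Icc, Set.singleton_subset_iff, Set.subset_compl_singleton_iff]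
  have univ_notMem : Set.univ ∉ Set.Icc {z} {M.start}ᶜ := fun huniv =>
    huniv.2 (Set.mem_univ M.start) rfl
  rw [encard_atoms_of_range_eq (range_acceptsFrom h.surjective_eval), nonempty_eq,
    Set.encard_insert_of_notMem univ_notMem, encard_Icc_singleton_compl_singleton h.start_ne,
    Nat.cast_add, Nat.cast_one]

theorem complexity_atomicIntersection_univ (h : IsIdealWitness M z) :
    complexity (atomicIntersection M.acceptsFrom Set.univ) = Fintype.card Q := by
  have eq_accepts : atomicIntersection M.acceptsFrom Set.univ = M.accepts := by
    ext w
    simp only [mem_atomicIntersection, Set.mem_univ, iff_true]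
    exact ⟨fun hw => hw M.start, h.mem_acceptsFrom_of_mem_accepts⟩
  rw [eq_accepts, complexity_accepts h.surjective_eval h.acceptsFrom_injective,
    ENat.card_eq_coe_fintype_card]

section Complexity

variable [DecidableEq Q] {S : Finset Q}

theorem pairLanguage_mem_quotients (h : IsIdealWitness M z) (hz : z ∈ S) (hs : M.start ∉ S)
    {p : Finset Q × Finset Q} (hp : p ∈ normalPairs M.start z #S #Sᶜ) :
    pairLanguage M p.1 p.2 ∈ quotients (atomicIntersection M.acceptsFrom (S : Set Q)) := by
  obtain ⟨⟨hz', hs', -⟩, hcard, hcard'⟩ := mem_normalPairs.1 hp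
  obtain ⟨f, hf, image_f⟩ := exists_map_image_eq hz hz' hcard
  obtain ⟨g, hg, image_g⟩ := exists_map_image_eq (mem_compl.2 hs) hs' hcard'
  obtain ⟨w, hw⟩ := h.mem_transitionMonoid (fun q => if q ∈ S then f q else g q)
    ((if_neg hs).trans hg) ((if_pos hz).trans hf)
  have eval_eqOn : Set.EqOn (M.evalFrom · w) f S := fun q hq => (hw q).trans (if_pos hq)
  have eval_eqOn_compl : Set.EqOn (M.evalFrom · w) g (S : Set Q)ᶜ := fun q hq =>
    (hw q).trans (if_neg hq)
  refine ⟨w, ?_⟩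
  rw [leftQuotient_atomicIntersection, eval_eqOn.image_eq, eval_eqOn_compl.image_eq, ← image_f,
    ← image_g, coe_image, coe_image, coe_compl]

theorem leftQuotient_mem (h : IsIdealWitness M z) (hz : z ∈ S) (hs : M.start ∉ S) (w : List α) :
    (atomicIntersection M.acceptsFrom (S : Set Q)).leftQuotient w = ⊥ ∨
      ∃ p ∈ normalPairs M.start z #S #Sᶜ ∪ collapsedPairs M.start z,
        pairLanguage M p.1 p.2 = (atomicIntersection M.acceptsFrom (S : Set Q)).leftQuotient w := by
  by_cases hdisj : Disjoint ((M.evalFrom · w) '' S) ((M.evalFrom · w) '' (S : Set Q)ᶜ)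
  swap
  · exact Or.inl ((leftQuotient_atomicIntersection _ w).trans
      (pairLanguage_eq_bot_of_not_disjoint hdisj))
  refine Or.inr ?_
  obtain hw | hw := eq_or_ne (M.evalFrom M.start w) M.start
  · refine ⟨(S.image (M.evalFrom · w), Sᶜ.image (M.evalFrom · w)), mem_union_left _
      (mem_normalPairs.2 ⟨⟨mem_image.2 ⟨z, hz, h.evalFrom_sink w⟩,
        mem_image.2 ⟨M.start, mem_compl.2 hs, hw⟩, ?_⟩, card_image_le, card_image_le⟩), ?_⟩
    · rwa [← disjoint_coe, coe_image, coe_image, coe_compl]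
    · rw [leftQuotient_atomicIntersection, coe_image, coe_image, coe_compl]
  · have hwz : M.evalFrom M.start w ≠ z := fun hwz => hdisj.notMem_of_mem_left
      ⟨z, hz, h.evalFrom_sink w⟩ ⟨M.start, hs, hwz⟩
    refine ⟨({z}, {M.start, M.evalFrom M.start w}), mem_union_right _ (mem_image_of_mem _ ?_), ?_⟩
    · simp only [mem_compl, mem_insert, hw, mem_singleton, hwz, or_self, not_false_eq_true]
    · rw [h.leftQuotient_eq_of_evalFrom_start_ne hz hs hw hdisj, coe_pair, coe_singleton,
        h.pairLanguage_insert_start]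

theorem quotients_atomicIntersection (h : IsIdealWitness M z) (hz : z ∈ S) (hs : M.start ∉ S) :
    quotients (atomicIntersection M.acceptsFrom (S : Set Q)) =
      insert ⊥ ((fun p : Finset Q × Finset Q => pairLanguage M p.1 p.2) ''
        (normalPairs M.start z #S #Sᶜ ∪ collapsedPairs M.start z :)) := by
  refine Set.Subset.antisymm ?_ (Set.insert_subset ?_ (Set.image_subset_iff.2 fun p hp => ?_))
  · rintro _ ⟨w, rfl⟩
    exact h.leftQuotient_mem hz hs w
  · rw [← pairLanguage_eq_bot_of_not_disjoint (M := M) (X := {z}) (Y := {z}) (by simp)]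
    exact h.pairLanguage_singleton_mem_quotients hz hs z
  · obtain hp | hp := mem_union.1 hp
    · exact h.pairLanguage_mem_quotients hz hs hp
    · obtain ⟨j, -, rfl⟩ := mem_image.1 hp
      rw [Set.mem_preimage, coe_pair, coe_singleton, h.pairLanguage_insert_start]
      exact h.pairLanguage_singleton_mem_quotients hz hs j

theorem complexity_atomicIntersection (h : IsIdealWitness M z) (hz : z ∈ S) (hs : M.start ∉ S) :
    complexity (atomicIntersection M.acceptsFrom (S : Set Q)) =
      (1 + #(normalPairs M.start z #S #Sᶜ ∪ collapsedPairs M.start z) : ℕ) := by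
  have isNormalPair {p : Finset Q × Finset Q}
      (hp : p ∈ normalPairs M.start z #S #Sᶜ ∪ collapsedPairs M.start z) :
      IsNormalPair M.start z p :=
    (mem_union.1 hp).elim (fun hp => (mem_normalPairs.1 hp).1)
      (isNormalPair_of_mem_collapsedPairs h.start_ne)
  rw [complexity, h.quotients_atomicIntersection hz hs, Set.encard_insert_of_notMem,
    (h.pairLanguage_injOn.mono fun p hp => isNormalPair hp).encard_image,
    Set.encard_coe_eq_coe_finsetCard, add_comm, Nat.cast_add, Nat.cast_one]
  rintro ⟨p, hp, hbot⟩
  obtain ⟨hzp, hsp, hdisj⟩ := isNormalPair hp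
  exact h.pairLanguage_ne_bot hzp hsp (disjoint_coe.2 hdisj) hbot

theorem complexity_atomicIntersection_compl_start (h : IsIdealWitness M z) :
    complexity (atomicIntersection M.acceptsFrom (({M.start}ᶜ : Finset Q) : Set Q)) =
      (2 ^ (Fintype.card Q - 2) + Fintype.card Q - 1 : ℕ) := by
  have two_le_card : 2 ≤ Fintype.card Q := card_pair h.start_ne ▸ card_le_univ {M.start, z}
  rw [h.complexity_atomicIntersection (by simp [h.start_ne.symm]) (by simp), compl_compl,
    card_compl, card_singleton, card_union_of_disjoint (disjoint_normalPairs_collapsedPairs _),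
    card_normalPairs_one h.start_ne, card_collapsedPairs h.start_ne]
  congr 1
  lia

theorem complexity_atomicIntersection_of_two_le_card_compl (h : IsIdealWitness M z) (hz : z ∈ S)
    (hs : M.start ∉ S) (hS : 2 ≤ #Sᶜ) :
    complexity (atomicIntersection M.acceptsFrom (S : Set Q)) =
      (1 + ∑ x ∈ Icc 1 #S, ∑ y ∈ Icc 1 (Fintype.card Q - #S),
        (Fintype.card Q - 2).choose (x - 1) * (Fintype.card Q - x - 1).choose (y - 1) : ℕ) := by
  rw [h.complexity_atomicIntersection hz hs, union_eq_left.2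
    (collapsedPairs_subset_normalPairs h.start_ne (card_pos.2 ⟨z, hz⟩) hS),
    card_normalPairs h.start_ne, card_compl]

end Complexity

end IsIdealWitness

section Witnesses

variable {n : ℕ}

theorem unitary_eq_update (p q : Fin n) : unitary p q = Function.update id p q := by
  funext i
  rw [Function.update_apply]
  rfl

theorem cycle_eq_cycleIcc {p q : Fin n} (h : p ≤ q) : cycle p q = Fin.cycleIcc p q := by
  have : NeZero n := NeZero.of_pos p.pos
  funext i
  rw [cycle]
  obtain hip | hpi := lt_or_ge i p
  · rw [dif_neg fun hi => hi.1.not_gt hip, if_neg (hip.trans_le h).ne, Fin.cycleIcc_of_lt hip]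
  obtain hiq | rfl | hqi := lt_trichotomy i q
  · rw [dif_pos ⟨hpi, hiq⟩, Fin.cycleIcc_of_ge_of_lt hpi hiq, Fin.ext_iff,
      Fin.val_add_one_of_lt' (by lia)]
  · rw [dif_neg fun hi => hi.2.false, if_pos rfl, Fin.cycleIcc_of_last h]
  · rw [dif_neg fun hi => hi.2.not_gt hqi, if_neg hqi.ne', Fin.cycleIcc_of_gt hqi]

theorem sameCycle_cycleIcc {p q i : Fin n} (hpq : p < q) (hi : i ∈ Set.Icc p q) :
    (Fin.cycleIcc p q).SameCycle p i := by
  refine (Fin.isCycle_cycleIcc hpq).sameCycle ?_ ?_ <;> rw [← cycle_eq_cycleIcc hpq.le] <;>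
    grind [cycle]

theorem exists_evalFrom_eq_of_step_eq {α Q : Type} {M : DFA α Q} {z p : Q} {x : α}
    (hT : ∀ t : Q → Q, t M.start = M.start → t z = z → t ∈ transitionMonoid M)
    (hs : M.start ≠ p) (hz : z ≠ p) (hx : ∀ q ≠ z, M.step q x = p) (j : Q) :
    ∃ w, ∀ q ≠ z, M.evalFrom q w = j := by
  classical
  obtain ⟨w, hw⟩ := hT (Function.update id p j) (Function.update_of_ne hs ..)
    (Function.update_of_ne hz ..)
  refine ⟨x :: w, fun q hq => ?_⟩
  rw [M.evalFrom_cons, hx q hq, hw, Function.update_self]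

theorem isIdealWitness_dfa2 : IsIdealWitness dfa2 (state 2 2 (by lia)) where
  accept_eq := rfl
  start_ne := by decide
  step_sink := by rintro (_ | _) <;> rfl
  step_start := by
    rintro (_ | _)
    · exact Or.inl rfl
    · exact Or.inr (by decide)
  mem_transitionMonoid _ hs hz := ⟨[], Fin.forall_fin_two.2 ⟨hs.symm, hz.symm⟩⟩
  exists_collapse j := by
    fin_cases j
    · exact ⟨[], by decide⟩
    · exact ⟨[Letters2.b], by decide⟩

theorem mem_transitionMonoid_dfa3 {t : Fin 3 → Fin 3} (h₀ : t 0 = 0) (h₂ : t 2 = 2) :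
    t ∈ transitionMonoid dfa3 := by
  have eq_update : t = Function.update id 1 (t 1) := by
    rw [Function.eq_update_iff]
    grind
  rw [eq_update, ← unitary_eq_update]
  generalize t 1 = q
  fin_cases q
  · exact step_mem_transitionMonoid dfa3 .d
  · exact ⟨[], by decide⟩
  · exact step_mem_transitionMonoid dfa3 .c

theorem isIdealWitness_dfa3 : IsIdealWitness dfa3 (state 3 3 (by lia)) where
  accept_eq := rfl
  start_ne := by decide
  step_sink := by rintro (_ | _ | _ | _) <;> rfl
  step_start := by
    rintro (_ | _ | _ | _)
    · exact Or.inl rfl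
    · exact Or.inr (by decide)
    · exact Or.inl rfl
    · exact Or.inl rfl
  mem_transitionMonoid t hs hz := mem_transitionMonoid_dfa3 hs hz
  exists_collapse := exists_evalFrom_eq_of_step_eq (p := state 3 2 (by lia)) (x := .b)
    (fun t hs hz => mem_transitionMonoid_dfa3 hs hz) (by decide) (by decide) (by decide)

section Large

variable (hn : 4 ≤ n) {i j : Fin n}

theorem swap_mem_transitionMonoid_dfaLarge
    (hi : i ∈ Set.Icc (state n 2 (by lia)) (state n (n - 1) (by lia)))
    (hj : j ∈ Set.Icc (state n 2 (by lia)) (state n (n - 1) (by lia))) :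
    ⇑(Equiv.swap i j) ∈ transitionMonoid (dfaLarge n hn) := by
  set p := state n 2 (by lia)
  set q := state n (n - 1) (by lia)
  have hpq : p < q := by grind [state]
  have rotate_p : Fin.cycleIcc p q p = state n 3 (by lia) := by
    rw [← cycle_eq_cycleIcc hpq.le, cycle, dif_pos ⟨le_rfl, hpq⟩]
    rfl
  refine swap_mem_of_sameCycle (P := (transitionMonoid (dfaLarge n hn)).comap MulAction.toEndHom)
    ?_ ?_ (sameCycle_cycleIcc hpq hi) (sameCycle_cycleIcc hpq hj)
  · change ⇑(Fin.cycleIcc p q) ∈ transitionMonoid (dfaLarge n hn)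
    rw [← cycle_eq_cycleIcc hpq.le]
    exact step_mem_transitionMonoid (dfaLarge n hn) .a
  · rw [rotate_p]
    exact step_mem_transitionMonoid (dfaLarge n hn) .b

theorem update_mem_transitionMonoid_dfaLarge
    (hi : i ∈ Set.Icc (state n 2 (by lia)) (state n (n - 1) (by lia))) (hij : i ≠ j) :
    Function.update id i j ∈ transitionMonoid (dfaLarge n hn) := by
  have hswap := fun i hi j hj => swap_mem_transitionMonoid_dfaLarge (i := i) (j := j) hn hi hj
  obtain hj | rfl | rfl : j ∈ Set.Icc (state n 2 (by lia)) (state n (n - 1) (by lia)) ∨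
      j = state n 1 (by lia) ∨ j = state n n (by lia) := by grind [state]
  · refine update_mem_of_swap_mem hswap (p := state n (n - 1) (by lia)) (q := state n 2 (by lia))
      (by grind [state]) (by grind [state]) (by grind [state]) ?_ hi hj hij
    exact unitary_eq_update .. ▸ step_mem_transitionMonoid (dfaLarge n hn) .c
  · refine update_mem_of_swap_mem_of_notMem hswap (p := state n (n - 1) (by lia))
      (by grind [state]) (by grind [state]) ?_ hi
    exact unitary_eq_update .. ▸ step_mem_transitionMonoid (dfaLarge n hn) .d
  · refine update_mem_of_swap_mem_of_notMem hswap (p := state n 2 (by lia))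
      (by grind [state]) (by grind [state]) ?_ hi
    exact unitary_eq_update .. ▸ step_mem_transitionMonoid (dfaLarge n hn) .f

theorem mem_transitionMonoid_dfaLarge {t : Fin n → Fin n}
    (ht : t (state n 1 (by lia)) = state n 1 (by lia))
    (ht' : t (state n n (by lia)) = state n n (by lia)) :
    t ∈ transitionMonoid (dfaLarge n hn) := by
  refine mem_of_swap_mem_of_update_mem
    (fun i hi j hj => swap_mem_transitionMonoid_dfaLarge hn hi hj)
    (fun i hi j hij => update_mem_transitionMonoid_dfaLarge hn hi hij) fun i hi => ?_
  obtain rfl | rfl : i = state n 1 (by lia) ∨ i = state n n (by lia) := by grind [state]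
  · exact ht
  · exact ht'

theorem isIdealWitness_dfaLarge : IsIdealWitness (dfaLarge n hn) (state n n (by lia)) := by
  have step_e (q : Fin n) (hq : q ≠ state n n (by lia)) :
      (dfaLarge n hn).step q .e = state n 2 (by lia) := if_pos (by grind [state])
  have step_sink (x : Letters6) :
      (dfaLarge n hn).step (state n n (by lia)) x = state n n (by lia) := by
    cases x <;> grind [dfaLarge, cycle, unitary, collapse, state]
  have start_ne : (dfaLarge n hn).start ≠ state n n (by lia) := by grind [dfaLarge, state]
  have step_start (x : Letters6) (hx : x ≠ .e) :
      (dfaLarge n hn).step (dfaLarge n hn).start x = (dfaLarge n hn).start := by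
    cases x <;> grind [dfaLarge, cycle, unitary, state]
  refine ⟨rfl, start_ne, step_sink, fun x => ?_, fun t => mem_transitionMonoid_dfaLarge hn,
    exists_evalFrom_eq_of_step_eq (fun t => mem_transitionMonoid_dfaLarge hn) ?_ ?_ step_e⟩
  · obtain rfl | hx := eq_or_ne x .e
    · refine Or.inr fun q => ?_
      obtain rfl | hq := eq_or_ne q (state n n (by lia))
      · exact Or.inr (step_sink _)
      · exact Or.inl ((step_e q hq).trans (step_e _ start_ne).symm)
    · exact Or.inl (step_start x hx)
  · grind [dfaLarge, state]
  · grind [state]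

end Large

theorem dfa_start : ∀ (n : ℕ) (hn : 2 ≤ n), (dfa n hn).start = state n 1 (by lia)
  | 0, h => absurd h (by lia)
  | 1, h => absurd h (by lia)
  | 2, _ => rfl
  | 3, _ => rfl
  | _ + 4, _ => rfl

theorem isIdealWitness_dfa : ∀ (n : ℕ) (hn : 2 ≤ n), IsIdealWitness (dfa n hn) (state n n (by lia))
  | 0, h => absurd h (by lia)
  | 1, h => absurd h (by lia)
  | 2, _ => isIdealWitness_dfa2
  | 3, _ => isIdealWitness_dfa3
  | _ + 4, _ => isIdealWitness_dfaLarge (by lia)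

end Witnesses

end TwoSidedAtoms

/-- With `L_n` the language of `D_n` and `K_i` the language of state `i` of `D_n`: `L_n` is a
two-sided ideal of complexity `n`, its quotients are exactly the pairwise distinct `K_1, …, K_n`,
it has `2 ^ (n - 2) + 1` atoms, and each atom `A_S` meets the bound on its complexity. -/
theorem mainTheorem2 (n : ℕ) (hn : 2 ≤ n) :
    TwoSidedAtoms.IsTwoSidedIdeal (TwoSidedAtoms.dfa n hn).accepts ∧
    TwoSidedAtoms.complexity (TwoSidedAtoms.dfa n hn).accepts = (n : ℕ∞) ∧
    Function.Injective (TwoSidedAtoms.dfa n hn).acceptsFrom ∧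
    Set.range (TwoSidedAtoms.dfa n hn).acceptsFrom =
      TwoSidedAtoms.quotients (TwoSidedAtoms.dfa n hn).accepts ∧
    {A | TwoSidedAtoms.IsAtomOf (TwoSidedAtoms.dfa n hn).accepts A}.encard =
      ((2 ^ (n - 2) + 1 : ℕ) : ℕ∞) ∧
    ∀ S : Finset (Fin n),
      TwoSidedAtoms.IsAtomOf (TwoSidedAtoms.dfa n hn).accepts
        (TwoSidedAtoms.atomicIntersection (TwoSidedAtoms.dfa n hn).acceptsFrom (S : Set (Fin n))) →
      TwoSidedAtoms.complexity
        (TwoSidedAtoms.atomicIntersection (TwoSidedAtoms.dfa n hn).acceptsFrom (S : Set (Fin n))) =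
          (TwoSidedAtoms.atomBound n hn S : ℕ∞) := by
  have h := TwoSidedAtoms.isIdealWitness_dfa n hn
  refine ⟨h.isTwoSidedIdeal, ?_, h.acceptsFrom_injective,
    TwoSidedAtoms.range_acceptsFrom h.surjective_eval, ?_, fun S hS => ?_⟩
  · rw [TwoSidedAtoms.complexity_accepts h.surjective_eval h.acceptsFrom_injective,
      ENat.card_eq_coe_fintype_card, Fintype.card_fin]
  · rw [h.encard_atoms, Fintype.card_fin]
  · rw [TwoSidedAtoms.atomBound, ← Finset.compl_eq_univ_sdiff, ← TwoSidedAtoms.dfa_start n hn]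
    split_ifs with S_eq_univ S_eq_compl
    · rw [S_eq_univ, Finset.coe_univ, h.complexity_atomicIntersection_univ, Fintype.card_fin]
    · rw [S_eq_compl, h.complexity_atomicIntersection_compl_start, Fintype.card_fin]
    · obtain ⟨hz, hs⟩ := (h.nonempty_atomicIntersection_iff.1 hS.1).resolve_left
        (mt Finset.coe_eq_univ.1 S_eq_univ)
      have two_le_card_compl : 2 ≤ Sᶜ.card := by
        refine Finset.one_lt_card_iff_nontrivial.2
          ((Finset.nontrivial_iff_ne_singleton (Finset.mem_compl.2 hs)).2 fun hS' => ?_)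
        exact S_eq_compl (compl_eq_comm.1 hS').symm
      rw [h.complexity_atomicIntersection_of_two_le_card_compl hz hs two_le_card_compl,
        Fintype.card_fin]
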